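/- Let $k>\ell\ge 1$ be coprime integers and let $A(z),B(z)$ be nonzero complex polynomials with $\deg(A(z)B(z))\ge 1$. Let $\{P_n(z)\}_{n\ge 0}$ be the polynomial sequence given by $P_0(z)=1$, $P_{-1}(z)=\cdots=P_{1-k}(z)=0$ and $$P_n(z)+B(z)P_{n-\ell}(z)+A(z)P_{n-k}(z)=0\qquad(n\ge 1).$$ Let $z_0\in\mathbb{C}$ be a zero of some $P_n(z)$ that is not the zero polynomial, with $A(z_0)\ne 0$, and put $D(t;z_0)=A(z_0)t^k+B(z_0)t^\ell+1$. Then at least one of the following holds: - $D(t;z_0)$ has two distinct zeros of equal modulus; - $D(t;z_0)$ has null-collinear zeros, that is, some real line through the origin $O$ of $\mathbb{C}$ carries zeros of $D(t;z_0)$ on both sides of $O$, and exactly three distinct zeros of $D(t;z_0)$ lie on this line if $k$ is odd, exactly two if $k$ is even. Moreover, every real line through $O$ that carries zeros of $D(t;z_0)$ on both sides of $O$ contains exactly three zeros of $D(t;z_0)$ if $k$ is odd and exactly two if $k$ is even, counted with multiplicity. -/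

import Mathlib

open Polynomial

/-- The polynomial sequence `P₀ = 1`, `Pₙ = -B Pₙ₋ₗ - A Pₙ₋ₖ` for `n ≥ 1`, where terms with a
negative index are `0`. (The side conditions `1 ≤ l`, `1 ≤ k` only make the recursion
well-founded.) -/
noncomputable def recSeq (k l : ℕ) (A B : ℂ[X]) : ℕ → ℂ[X]
  | 0 => 1
  | n + 1 =>
      -(B * (if _h : 1 ≤ l ∧ l ≤ n + 1 then recSeq k l A B (n + 1 - l) else 0))
        - A * (if _h : 1 ≤ k ∧ k ≤ n + 1 then recSeq k l A B (n + 1 - k) else 0)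
  termination_by n => n
  decreasing_by all_goals omega

theorem recSeq_zero (k l : ℕ) (A B : ℂ[X]) : recSeq k l A B 0 = 1 := by
  rw [recSeq]

/-- The three-term recurrence, valid for all `n ≥ 1`. -/
theorem recSeq_rec (k l : ℕ) (hl : 1 ≤ l) (hk : 1 ≤ k) (A B : ℂ[X]) (n : ℕ) (hn : 1 ≤ n) :
    recSeq k l A B n + B * (if l ≤ n then recSeq k l A B (n - l) else 0)
      + A * (if k ≤ n then recSeq k l A B (n - k) else 0) = 0 := by
  obtain ⟨m, rfl⟩ : ∃ m, n = m + 1 := ⟨n - 1, by omega⟩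
  rw [recSeq]
  simp only [hl, hk, true_and, dite_eq_ite]
  ring

/-- The set of zeros of all the nonzero polynomials in a sequence. -/
def seqZeros (P : ℕ → ℂ[X]) : Set ℂ :=
  {z | ∃ n : ℕ, P n ≠ 0 ∧ (P n).IsRoot z}

/-- The set of zeros of one polynomial. -/
def polyZeros (A : ℂ[X]) : Set ℂ :=
  {z | A.IsRoot z}

/-- The trinomial `D(t; z₀) = A(z₀) t ^ k + B(z₀) t ^ l + 1`, as a polynomial in `t`. -/
noncomputable def trinomialAt (k l : ℕ) (A B : ℂ[X]) (z₀ : ℂ) : ℂ[X] :=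
  C (A.eval z₀) * X ^ k + C (B.eval z₀) * X ^ l + 1

/-- The real line through the origin of `ℂ` with direction `u` (used for `u ≠ 0`). -/
def lineThroughOrigin (u : ℂ) : Set ℂ :=
  {t | ∃ r : ℝ, t = (r : ℂ) * u}

/-- On the line with direction `u` the polynomial `D` has a zero on either side of the origin. -/
def HasZerosOnBothSides (D : ℂ[X]) (u : ℂ) : Prop :=
  (∃ r : ℝ, 0 < r ∧ D.IsRoot ((r : ℂ) * u)) ∧ (∃ r : ℝ, r < 0 ∧ D.IsRoot ((r : ℂ) * u))

/-- `D` has exactly `m` null-collinear zeros on the line with direction `u`: exactly `m` distinct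
zeros of `D` lie on that line, with at least one on either side of the origin. -/
def HasNullCollinearZeros (D : ℂ[X]) (u : ℂ) (m : ℕ) : Prop :=
  HasZerosOnBothSides D u ∧ {t : ℂ | D.IsRoot t ∧ t ∈ lineThroughOrigin u}.ncard = m

open Classical in
/-- The zeros of `D` on the line with direction `u`, listed with multiplicity. -/
noncomputable def zerosOnLine (D : ℂ[X]) (u : ℂ) : Multiset ℂ :=
  D.roots.filter (fun t => t ∈ lineThroughOrigin u)

/-- The number of null-collinear zeros: three for odd `k`, two for even `k`. -/
def nullCollinearCount (k : ℕ) : ℕ :=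
  if Odd k then 3 else 2

/-! Put `a = A(z₀)`, `b = B(z₀)`. If `b = 0`, the zeros of `D` are the `k`-th roots of one number.
If `b ≠ 0`, the key fact is that `(-a)^l / (-b)^k` is a negative real (`arg_eq_pi_of_isRoot`).
Otherwise, up to conjugation, multiplying the `n`-th term by `u^n` turns the coefficients into
positive multiples of `exp (-iδ)` and `exp (iδ)` with `(k + l)δ < π`. The terms then have slowly
varying arguments, so the two summands never cancel. A term vanishes only if both its predecessors
do, and inductively only if its polynomial is zero.

A rotation `t ↦ u t` therefore makes `D` the real trinomial `|a| t^k + (-1)^l |b| t^l + 1`. If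
distinct zeros have distinct moduli, conjugation forces all zeros to be real, and Descartes' rule
leaves `k = 2` or `k = 3`. Positivity of the rotated sequence excludes `k = 2` and a double zero for
`(k, l) = (3, 1)`; Vieta's relations exclude `(3, 2)`. What remains is three distinct real zeros
with sum zero, hence of both signs.

The count with multiplicity is independent of the sequence: zeros on both sides of the origin make
`D` real on the line, and Descartes' bound, with parity for odd `k`, fixes their number. -/

/-! ### Slowly varying arguments for a rotated recurrence. -/

/-- A sum of two vectors whose arguments span less than a half turn has an argument in between,
and vanishes only if both vectors do. -/
theorem exists_polar_add {r₁ r₂ θ₁ θ₂ : ℝ} (h₁ : 0 ≤ r₁) (h₂ : 0 ≤ r₂) (hθ : θ₁ ≤ θ₂)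
    (hπ : θ₂ < θ₁ + Real.pi) :
    ∃ r θ : ℝ, 0 ≤ r ∧ θ₁ ≤ θ ∧ θ ≤ θ₂ ∧
      r₁ * Complex.exp (θ₁ * Complex.I) + r₂ * Complex.exp (θ₂ * Complex.I)
        = r * Complex.exp (θ * Complex.I) ∧ (r = 0 → r₁ = 0 ∧ r₂ = 0) := by
  set d : ℝ := θ₂ - θ₁ with hd
  set z : ℂ := r₁ + r₂ * Complex.exp (d * Complex.I) with hz
  have him : z.im = r₂ * Real.sin d := by
    simp [hz, Complex.exp_ofReal_mul_I_im]
  have hre : z.re = r₁ + r₂ * Real.cos d := by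
    simp [hz, Complex.exp_ofReal_mul_I_re]
  have hsin : 0 ≤ Real.sin d := Real.sin_nonneg_of_nonneg_of_le_pi (by linarith) (by linarith)
  have harg0 : 0 ≤ z.arg := by
    rw [Complex.arg_nonneg_iff, him]; positivity
  have hzero : ‖z‖ = 0 → r₁ = 0 ∧ r₂ = 0 := by
    intro h
    rw [norm_eq_zero] at h
    rw [h] at him hre
    simp only [Complex.zero_im, Complex.zero_re] at him hre
    rcases eq_or_lt_of_le (show 0 ≤ d by linarith) with h0 | h0
    · rw [← h0, Real.cos_zero] at hre
      constructor <;> linarith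
    · have : 0 < Real.sin d := Real.sin_pos_of_pos_of_lt_pi h0 (by linarith)
      have h2 : r₂ = 0 := by
        rcases mul_eq_zero.1 him.symm with h | h
        · exact h
        · exact absurd h this.ne'
      rw [h2] at hre
      exact ⟨by linarith, h2⟩
  have hrot : (r₁ : ℂ) * Complex.exp (θ₁ * Complex.I) + r₂ * Complex.exp (θ₂ * Complex.I)
      = z * Complex.exp (θ₁ * Complex.I) := by
    rw [hz, add_mul, mul_assoc, ← Complex.exp_add]
    rw [hd, ← add_mul]
    push_cast
    rw [sub_add_cancel]
  have hargd : z.arg ≤ d := by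
    by_contra! hlt
    have e1 := Complex.norm_mul_cos_arg z
    have e2 := Complex.norm_mul_sin_arg z
    -- Both sides are the imaginary part of `z * exp (-d * I)`.
    have e3 : ‖z‖ * Real.sin (z.arg - d) = - (r₁ * Real.sin d) := by
      rw [Real.sin_sub]
      linear_combination Real.cos d * e2 - Real.sin d * e1 + Real.cos d * him - Real.sin d * hre
    rcases eq_or_lt_of_le (show 0 ≤ d by linarith) with h0 | h0
    · have hz' : z = ((r₁ + r₂ : ℝ) : ℂ) := by
        rw [hz, ← h0]; simp
      rw [hz', Complex.arg_ofReal_of_nonneg (by positivity)] at hlt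
      linarith
    · have hpos : 0 < Real.sin (z.arg - d) :=
        Real.sin_pos_of_pos_of_lt_pi (by linarith) (by linarith [Complex.arg_le_pi z])
      have hn : ‖z‖ = 0 := by
        have : 0 ≤ r₁ * Real.sin d := by positivity
        have h3 : ‖z‖ * Real.sin (z.arg - d) ≤ 0 := by linarith
        have := norm_nonneg z
        nlinarith
      rw [norm_eq_zero] at hn
      rw [hn, Complex.arg_zero] at hlt
      linarith
  refine ⟨‖z‖, z.arg + θ₁, norm_nonneg _, by linarith, by linarith, ?_, hzero⟩
  rw [hrot]
  conv_lhs => rw [← Complex.norm_mul_exp_arg_mul_I z]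
  rw [mul_assoc, ← Complex.exp_add, Complex.ofReal_add, add_mul]

/-- Moving by `+l` and `-k` inside a window of length `k + l` bounds the increase of `ω`. -/
theorem angle_le_of_steps {k l : ℕ} (hl : 1 ≤ l) (hk : 1 ≤ k) {δ : ℝ} {ω : ℤ → ℝ} {n : ℤ}
    (hω : ∀ m < n, ω (m - l) - δ ≤ ω m ∧ ω m ≤ ω (m - k) + δ) :
    ω (n - k) ≤ ω (n - l) + ((k : ℝ) + l - 2) * δ := by
  -- Walk from `n - k`, adding `l` while this stays below `n` and subtracting `k` otherwise. Either
  -- move adds `l` modulo `k + l` and costs at most `δ`.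
  have key : ∀ j : ℕ, ∃ m' : ℤ, n - k - l ≤ m' ∧ m' < n ∧
      ((k : ℤ) + l) ∣ (n - k + j * l - m') ∧ ω (n - k) ≤ ω m' + j * δ := by
    intro j
    induction j with
    | zero => exact ⟨n - k, by omega, by omega, by simp, by simp⟩
    | succ j ih =>
      obtain ⟨m, h1, h2, h3, h4⟩ := ih
      by_cases hm : m < n - l
      · refine ⟨m + l, by omega, by omega, ?_, ?_⟩
        · rwa [show n - k + ((j + 1 : ℕ) : ℤ) * l - (m + l) = n - k + j * l - m by push_cast; ring]
        · have := (hω (m + l) (by omega)).1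
          rw [add_sub_cancel_right] at this
          push_cast; linarith
      · refine ⟨m - k, by omega, by omega, ?_, ?_⟩
        · have := dvd_add h3 (dvd_refl ((k : ℤ) + l))
          rwa [show n - k + ((j + 1 : ℕ) : ℤ) * l - (m - k) = n - k + j * l - m + (k + l) by
            push_cast; ring]
        · have := (hω m h2).2
          push_cast; linarith
  -- After `k + l - 2` moves the position is congruent to `n - l` modulo `k + l`; the window
  -- contains each residue once, so the walk has arrived there.
  obtain ⟨m, h1, h2, h3, h4⟩ := key (k + l - 2)
  have hc : ((k + l - 2 : ℕ) : ℤ) = k + l - 2 := by omega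
  have hcr : ((k + l - 2 : ℕ) : ℝ) = k + l - 2 := by exact_mod_cast congrArg (Int.cast (R := ℝ)) hc
  rw [hc] at h3
  rw [hcr] at h4
  have h5 : ((k : ℤ) + l) ∣ (n - l - m) := by
    have := dvd_sub h3 (dvd_mul_right ((k : ℤ) + l) (l - 1))
    rwa [show n - k + (k + l - 2) * l - m - (k + l) * (l - 1) = n - l - m by ring] at this
  have h6 : n - l - m = 0 := Int.eq_zero_of_abs_lt_dvd h5 (by rw [abs_lt]; omega)
  rwa [show n - l = m by omega]

theorem rotated_sum (s₁ s₂ δ r₁ r₂ ω₁ ω₂ : ℝ) :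
    s₁ * Complex.exp (-δ * Complex.I) * (r₁ * Complex.exp (ω₁ * Complex.I))
      + s₂ * Complex.exp (δ * Complex.I) * (r₂ * Complex.exp (ω₂ * Complex.I))
    = (s₁ * r₁ : ℝ) * Complex.exp ((ω₁ - δ : ℝ) * Complex.I)
      + (s₂ * r₂ : ℝ) * Complex.exp ((ω₂ + δ : ℝ) * Complex.I) := by
  have e1 : ((ω₁ - δ : ℝ) : ℂ) * Complex.I = -δ * Complex.I + ω₁ * Complex.I := by
    push_cast; ring
  have e2 : ((ω₂ + δ : ℝ) : ℂ) * Complex.I = δ * Complex.I + ω₂ * Complex.I := by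
    push_cast; ring
  rw [e1, e2, Complex.exp_add, Complex.exp_add]
  push_cast; ring

/-- The values of the rotated recurrence can be given arguments that vary slowly. -/
theorem exists_angle {k l : ℕ} (hl : 1 ≤ l) (hk : 1 ≤ k) {δ s₁ s₂ : ℝ} (hδ : 0 ≤ δ)
    (hδπ : ((k : ℝ) + l) * δ < Real.pi) (h₁ : 0 ≤ s₁) (h₂ : 0 ≤ s₂) {q : ℤ → ℂ}
    (hneg : ∀ n < 0, q n = 0) (h0 : q 0 = 1)
    (hq : ∀ n, 1 ≤ n → q n = s₁ * Complex.exp (-δ * Complex.I) * q (n - l)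
      + s₂ * Complex.exp (δ * Complex.I) * q (n - k)) (N : ℕ) :
    ∃ ω : ℤ → ℝ, (∀ n < (N : ℤ) + 1, ∃ r : ℝ, 0 ≤ r ∧ q n = r * Complex.exp (ω n * Complex.I)) ∧
      ∀ n < (N : ℤ) + 1, ω (n - l) - δ ≤ ω n ∧ ω n ≤ ω (n - k) + δ := by
  induction N with
  | zero =>
    refine ⟨fun _ => 0, fun n hn => ?_, fun n _ => by simp [hδ]⟩
    rcases lt_or_eq_of_le (show n ≤ 0 by omega) with h | h
    · exact ⟨0, le_rfl, by simp [hneg n h]⟩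
    · exact ⟨1, by simp, by simp [h, h0]⟩
  | succ N ih =>
    obtain ⟨ω, hr, hω⟩ := ih
    set n : ℤ := (N : ℤ) + 1 with hn
    obtain ⟨r₁, hr₁, e₁⟩ := hr (n - l) (by omega)
    obtain ⟨r₂, hr₂, e₂⟩ := hr (n - k) (by omega)
    have hup := angle_le_of_steps hl hk hω
    have hlow1 := (hω (n - k) (by omega)).1
    have hlow2 := (hω (n - l) (by omega)).2
    rw [sub_right_comm] at hlow2
    -- The two arguments differ by at most `(k + l - 2)δ + 2δ < π`. The new `θ` obeys both bounds
    -- even when the sum is zero, so vanishing terms do not stop the induction.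
    obtain ⟨r, θ, hr0, hθ1, hθ2, he, -⟩ := exists_polar_add (r₁ := s₁ * r₁) (r₂ := s₂ * r₂)
      (θ₁ := ω (n - l) - δ) (θ₂ := ω (n - k) + δ) (by positivity) (by positivity)
      (by linarith) (by linarith)
    refine ⟨Function.update ω n θ, fun m hm => ?_, fun m hm => ?_⟩
    · rcases lt_or_eq_of_le (show m ≤ n by push_cast at hm; omega) with h | h
      · rw [Function.update_of_ne h.ne]
        exact hr m h
      · rw [h, Function.update_self]
        refine ⟨r, hr0, ?_⟩
        rw [← he, hq n (by omega), e₁, e₂, rotated_sum]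
    · rcases lt_or_eq_of_le (show m ≤ n by push_cast at hm; omega) with h | h
      · rw [Function.update_of_ne h.ne, Function.update_of_ne (by omega),
          Function.update_of_ne (by omega)]
        exact hω m h
      · rw [h, Function.update_self, Function.update_of_ne (by omega),
          Function.update_of_ne (by omega)]
        exact ⟨hθ1, hθ2⟩

/-- The summands have arguments less than a half turn apart, so they cannot cancel. -/
theorem eq_zero_of_rotated_rec_eq_zero {k l : ℕ} (hl : 1 ≤ l) (hk : 1 ≤ k) {δ s₁ s₂ : ℝ}
    (hδ : 0 ≤ δ) (hδπ : ((k : ℝ) + l) * δ < Real.pi) (h₁ : 0 < s₁) (h₂ : 0 < s₂) {q : ℤ → ℂ}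
    (hneg : ∀ n < 0, q n = 0) (h0 : q 0 = 1)
    (hq : ∀ n, 1 ≤ n → q n = s₁ * Complex.exp (-δ * Complex.I) * q (n - l)
      + s₂ * Complex.exp (δ * Complex.I) * q (n - k)) {n : ℤ} (hn : 1 ≤ n) (hz : q n = 0) :
    q (n - l) = 0 ∧ q (n - k) = 0 := by
  obtain ⟨N, hN⟩ : ∃ N : ℕ, n = (N : ℤ) + 1 := ⟨(n - 1).toNat, by omega⟩
  obtain ⟨ω, hr, hω⟩ := exists_angle hl hk hδ hδπ h₁.le h₂.le hneg h0 hq N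
  rw [← hN] at hr hω
  obtain ⟨r₁, hr₁, e₁⟩ := hr (n - l) (by omega)
  obtain ⟨r₂, hr₂, e₂⟩ := hr (n - k) (by omega)
  have hup := angle_le_of_steps hl hk hω
  have hlow1 := (hω (n - k) (by omega)).1
  have hlow2 := (hω (n - l) (by omega)).2
  rw [sub_right_comm] at hlow2
  obtain ⟨r, θ, hr0, hθ1, hθ2, he, hzero⟩ := exists_polar_add (r₁ := s₁ * r₁) (r₂ := s₂ * r₂)
    (θ₁ := ω (n - l) - δ) (θ₂ := ω (n - k) + δ) (by positivity) (by positivity)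
    (by linarith) (by linarith)
  have hqn : q n = r * Complex.exp (θ * Complex.I) := by
    rw [← he, hq n hn, e₁, e₂, rotated_sum]
  have hr' : r = 0 := by
    rw [hqn] at hz
    simpa using hz
  obtain ⟨z1, z2⟩ := hzero hr'
  rw [e₁, e₂, (mul_eq_zero.1 z1).resolve_left h₁.ne', (mul_eq_zero.1 z2).resolve_left h₂.ne']
  simp

/-! ### From complex coefficients to the argument condition at a zero. -/

/-- Simultaneous roots of coprime orders. -/
theorem exists_pow_eq_and_pow_eq {k l : ℕ} (hkl : Nat.Coprime k l) {x y : ℂ} (hx : x ≠ 0)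
    (hy : y ≠ 0) (h : x ^ k = y ^ l) : ∃ u : ℂ, u ≠ 0 ∧ u ^ l = x ∧ u ^ k = y := by
  have hb := Nat.gcd_eq_gcd_ab k l
  rw [hkl.gcd_eq_one, Nat.cast_one] at hb
  set s := Nat.gcdA k l
  set t := Nat.gcdB k l
  have hz : x ^ (k : ℤ) = y ^ (l : ℤ) := by exact_mod_cast h
  refine ⟨x ^ t * y ^ s, by positivity, ?_, ?_⟩
  · calc (x ^ t * y ^ s) ^ l = x ^ (l * t) * (y ^ (l : ℤ)) ^ s := by
          rw [mul_pow, ← zpow_natCast, ← zpow_natCast, ← zpow_mul, ← zpow_mul, ← zpow_mul,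
            mul_comm t, mul_comm s]
      _ = x ^ (1 : ℤ) := by rw [← hz, ← zpow_mul, ← zpow_add₀ hx, hb, add_comm]
      _ = x := zpow_one x
  · calc (x ^ t * y ^ s) ^ k = (x ^ (k : ℤ)) ^ t * y ^ (k * s) := by
          rw [mul_pow, ← zpow_natCast, ← zpow_natCast, ← zpow_mul, ← zpow_mul, ← zpow_mul,
            mul_comm t, mul_comm s]
      _ = y ^ (1 : ℤ) := by rw [hz, ← zpow_mul, ← zpow_add₀ hy, hb, add_comm]
      _ = y := zpow_one y

/-- Rescaling by `u ^ n` reduces to the rotated recurrence. The prescribed values of `u ^ l` and `u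
^ k` are compatible exactly when `(k + l)δ` is an argument of `c₂ ^ l / c₁ ^ k`, which dictates `δ`.
-/
theorem eq_zero_of_rec_eq_zero_of_arg_nonneg {k l : ℕ} (hl : 1 ≤ l) (hk : 1 ≤ k)
    (hkl : Nat.Coprime k l) {c₁ c₂ : ℂ} (h₁ : c₁ ≠ 0) (h₂ : c₂ ≠ 0)
    (harg : 0 ≤ (c₂ ^ l / c₁ ^ k).arg) (hargπ : (c₂ ^ l / c₁ ^ k).arg < Real.pi) {p : ℤ → ℂ}
    (hneg : ∀ n < 0, p n = 0) (h0 : p 0 = 1)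
    (hp : ∀ n, 1 ≤ n → p n = c₁ * p (n - l) + c₂ * p (n - k)) {n : ℤ} (hn : 1 ≤ n)
    (hz : p n = 0) : p (n - l) = 0 ∧ p (n - k) = 0 := by
  set y := c₂ ^ l / c₁ ^ k with hy
  have hK : (0 : ℝ) < (k : ℝ) + l := by positivity
  set δ : ℝ := y.arg / ((k : ℝ) + l) with hδ
  have hKδ : ((k : ℝ) + l) * δ = y.arg := by rw [hδ]; field_simp
  have hn1 : (‖c₁‖ : ℂ) ≠ 0 := by simpa using h₁
  have hn2 : (‖c₂‖ : ℂ) ≠ 0 := by simpa using h₂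
  obtain ⟨u, hu, hul, huk⟩ := exists_pow_eq_and_pow_eq hkl
    (x := Complex.exp (-δ * Complex.I) * (‖c₁‖ / c₁)) (y := Complex.exp (δ * Complex.I) * (‖c₂‖ / c₂))
    (mul_ne_zero (Complex.exp_ne_zero _) (div_ne_zero hn1 h₁))
    (mul_ne_zero (Complex.exp_ne_zero _) (div_ne_zero hn2 h₂)) (by
      have hpol := Complex.norm_mul_exp_arg_mul_I y
      rw [← hKδ, hy, norm_div, norm_pow, norm_pow] at hpol
      push_cast at hpol
      rw [show ((k : ℂ) + l) * δ * Complex.I = k * (δ * Complex.I) + l * (δ * Complex.I) by ring,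
        Complex.exp_add, Complex.exp_nat_mul, Complex.exp_nat_mul] at hpol
      rw [neg_mul, Complex.exp_neg, mul_pow, mul_pow, inv_pow, div_pow, div_pow]
      have := Complex.exp_ne_zero (δ * Complex.I)
      field_simp at hpol ⊢
      linear_combination -hpol)
  have hu' : ∀ m : ℤ, u ^ m ≠ 0 := fun m => zpow_ne_zero m hu
  have := eq_zero_of_rotated_rec_eq_zero (q := fun m => p m * u ^ m) hl hk (δ := δ)
    (by positivity) (by rwa [hKδ]) (norm_pos_iff.2 h₁) (norm_pos_iff.2 h₂)
    (fun m hm => by simp [hneg m hm]) (by simp [h0])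
    (fun m hm => by
      have e1 : u ^ m = u ^ (m - l) * (Complex.exp (-δ * Complex.I) * (‖c₁‖ / c₁)) := by
        rw [← hul, ← zpow_natCast, ← zpow_add₀ hu]; congr 1; ring
      have e2 : u ^ m = u ^ (m - k) * (Complex.exp (δ * Complex.I) * (‖c₂‖ / c₂)) := by
        rw [← huk, ← zpow_natCast, ← zpow_add₀ hu]; congr 1; ring
      rw [hp m hm, add_mul]
      congr 1
      · rw [e1]; field_simp
      · rw [e2]; field_simp) hn (by simp [hz])
  simpa [hu'] using this

/-- A vanishing term of the recurrence forces its two predecessors to vanish, unless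
`c₂ ^ l / c₁ ^ k` is a negative real number. -/
theorem eq_zero_of_rec_eq_zero {k l : ℕ} (hl : 1 ≤ l) (hk : 1 ≤ k)
    (hkl : Nat.Coprime k l) {c₁ c₂ : ℂ} (h₁ : c₁ ≠ 0) (h₂ : c₂ ≠ 0)
    (hargπ : (c₂ ^ l / c₁ ^ k).arg ≠ Real.pi) {p : ℤ → ℂ}
    (hneg : ∀ n < 0, p n = 0) (h0 : p 0 = 1)
    (hp : ∀ n, 1 ≤ n → p n = c₁ * p (n - l) + c₂ * p (n - k)) {n : ℤ} (hn : 1 ≤ n)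
    (hz : p n = 0) : p (n - l) = 0 ∧ p (n - k) = 0 := by
  rcases le_or_gt 0 (c₂ ^ l / c₁ ^ k).arg with h | h
  · exact eq_zero_of_rec_eq_zero_of_arg_nonneg hl hk hkl h₁ h₂ h
      (lt_of_le_of_ne (Complex.arg_le_pi _) hargπ) hneg h0 hp hn hz
  · have harg : (starRingEnd ℂ c₂ ^ l / starRingEnd ℂ c₁ ^ k).arg = -(c₂ ^ l / c₁ ^ k).arg := by
      rw [← map_pow, ← map_pow, ← map_div₀, Complex.arg_conj, if_neg hargπ]
    have := eq_zero_of_rec_eq_zero_of_arg_nonneg (p := fun m => starRingEnd ℂ (p m)) hl hk hkl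
      (c₁ := starRingEnd ℂ c₁) (c₂ := starRingEnd ℂ c₂) (by simpa using h₁) (by simpa using h₂)
      (by rw [harg]; linarith) (by rw [harg]; linarith [Complex.neg_pi_lt_arg (c₂ ^ l / c₁ ^ k)])
      (fun m hm => by simp [hneg m hm]) (by simp [h0])
      (fun m hm => by simp [hp m hm]) hn (by simp [hz])
    simpa using this

theorem eval_recSeq_rec {k l : ℕ} (hl : 1 ≤ l) (hk : 1 ≤ k) (A B : ℂ[X]) (z : ℂ) {n : ℕ}
    (hn : 1 ≤ n) : (recSeq k l A B n).eval z
      = -(B.eval z) * (if l ≤ n then (recSeq k l A B (n - l)).eval z else 0)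
        + -(A.eval z) * (if k ≤ n then (recSeq k l A B (n - k)).eval z else 0) := by
  have h := congrArg (Polynomial.eval z) (recSeq_rec k l hl hk A B n hn)
  simp only [eval_add, eval_mul, eval_zero, apply_ite (Polynomial.eval z)] at h
  linear_combination h

/-- At a zero of the sequence, `(-A) ^ l / (-B) ^ k` is a negative real number. -/
theorem arg_eq_pi_of_isRoot {k l : ℕ} (hl : 1 ≤ l) (hk : 1 ≤ k) (hkl : Nat.Coprime k l)
    {A B : ℂ[X]} {z : ℂ} (ha : A.eval z ≠ 0) (hb : B.eval z ≠ 0) {n : ℕ}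
    (hn : recSeq k l A B n ≠ 0) (hz : (recSeq k l A B n).IsRoot z) :
    ((-(A.eval z)) ^ l / (-(B.eval z)) ^ k).arg = Real.pi := by
  by_contra harg
  set p : ℤ → ℂ := fun m => if 0 ≤ m then (recSeq k l A B m.toNat).eval z else 0 with hp
  have hnat : ∀ m : ℕ, p m = (recSeq k l A B m).eval z := fun m => by simp [hp]
  have hsub : ∀ m j : ℕ, p ((m : ℤ) - j)
      = if j ≤ m then (recSeq k l A B (m - j)).eval z else 0 := by
    intro m j
    by_cases h : j ≤ m
    · rw [if_pos h, ← hnat]; congr 1; omega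
    · rw [if_neg h]; exact if_neg (by omega)
  have hneg : ∀ m < 0, p m = 0 := fun m hm => if_neg (by omega)
  have h0 : p 0 = 1 := by simp [hp, recSeq_zero]
  have hrec : ∀ m, 1 ≤ m → p m = -(B.eval z) * p (m - l) + -(A.eval z) * p (m - k) := by
    intro m hm
    lift m to ℕ using (by omega)
    rw [hsub, hsub, hnat]
    exact eval_recSeq_rec hl hk A B z (by omega)
  -- Some terms may be zero polynomials, so vanishing at `z` is traced back to vanishing
  -- identically.
  have key : ∀ m : ℕ, recSeq k l A B m ≠ 0 → (recSeq k l A B m).eval z ≠ 0 := by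
    intro m
    induction m using Nat.strong_induction_on with
    | _ m ih =>
      intro hm he
      rcases Nat.eq_zero_or_pos m with rfl | hpos
      · simp [recSeq_zero] at he
      · have := eq_zero_of_rec_eq_zero hl hk hkl (neg_ne_zero.2 hb) (neg_ne_zero.2 ha) harg hneg h0
          hrec (n := m) (by omega) (by rw [hnat, he])
        rw [hsub, hsub] at this
        have hprev : ∀ j, 1 ≤ j → (if j ≤ m then (recSeq k l A B (m - j)).eval z else 0) = 0 →
            (if j ≤ m then recSeq k l A B (m - j) else 0) = 0 := by
          intro j hj h
          by_cases hjm : j ≤ m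
          · rw [if_pos hjm] at h ⊢
            by_contra hne
            exact ih (m - j) (by omega) hne h
          · rw [if_neg hjm]
        have hr := recSeq_rec k l hl hk A B m hpos
        rw [hprev l hl this.1, hprev k hk this.2] at hr
        exact hm (by simpa using hr)
  exact key n hn hz

/-! ### Counting real zeros of real trinomials. -/

theorem natDegree_trinomial_one {k l : ℕ} (hl : 1 ≤ l) (hlk : l < k) {α β : ℝ} (hα : α ≠ 0) :
    (C α * X ^ k + C β * X ^ l + 1 : ℝ[X]).natDegree = k := by
  compute_degree!
  · simp [hα, (show k ≠ l by omega), (show k ≠ 0 by omega)]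
  · omega
  · exact hlk.le

theorem degree_binomial_one_lt {k l : ℕ} (hlk : l < k) {α β : ℝ} (hα : α ≠ 0) :
    (C β * X ^ l + 1 : ℝ[X]).degree < (C α * X ^ k : ℝ[X]).degree := by
  rw [degree_C_mul_X_pow k hα]
  refine lt_of_le_of_lt (b := (l : WithBot ℕ)) ?_ (by exact_mod_cast hlk)
  compute_degree
  exact le_rfl

theorem signVariations_C_mul_X_pow_add {k : ℕ} {α : ℝ} (hα : α ≠ 0) {g : ℝ[X]}
    (hg : g.degree < (C α * X ^ k : ℝ[X]).degree) :
    (C α * X ^ k + g).signVariations = g.signVariations +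
      if SignType.sign α = -SignType.sign g.leadingCoeff then 1 else 0 := by
  have hne : C α * X ^ k + g ≠ 0 := by
    intro h
    have := degree_add_eq_left_of_degree_lt hg
    rw [h, degree_C_mul_X_pow k hα] at this
    simp at this
  rw [signVariations_eq_eraseLead_add_ite hne, eraseLead_add_of_degree_lt_left hg,
    leadingCoeff_add_of_degree_lt' hg, eraseLead_C_mul_X_pow]
  simp

theorem signVariations_binomial_one {l : ℕ} (hl : 1 ≤ l) (β : ℝ) :
    (C β * X ^ l + 1 : ℝ[X]).signVariations = if β < 0 then 1 else 0 := by
  have h1 : (1 : ℝ[X]).signVariations = 0 := by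
    simpa using signVariations_monomial (R := ℝ) 0 1
  by_cases hβ : β = 0
  · simp [hβ, h1]
  · rw [signVariations_C_mul_X_pow_add hβ, h1]
    · simp [sign_eq_neg_one_iff]
    · rw [degree_C_mul_X_pow l hβ, degree_one]
      exact_mod_cast hl

theorem sign_eq_neg_sign_iff {x y : ℝ} (hx : x ≠ 0) (hy : y ≠ 0) :
    SignType.sign x = -SignType.sign y ↔ x * y < 0 := by
  rcases lt_or_gt_of_ne hx with h1 | h1 <;> rcases lt_or_gt_of_ne hy with h2 | h2 <;>
    simp [h1, h2, sign_neg, sign_pos, mul_neg_iff, h1.le, h2.le]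

theorem signVariations_trinomial_one {k l : ℕ} (hl : 1 ≤ l) (hlk : l < k) {α β : ℝ}
    (hα : α ≠ 0) : (C α * X ^ k + C β * X ^ l + 1 : ℝ[X]).signVariations
      = if β = 0 then (if α < 0 then 1 else 0)
        else (if β < 0 then 1 else 0) + if α * β < 0 then 1 else 0 := by
  rw [add_assoc, signVariations_C_mul_X_pow_add hα (degree_binomial_one_lt hlk hα),
    signVariations_binomial_one hl]
  by_cases hβ : β = 0
  · simp [hβ, sign_eq_neg_one_iff]
  · rw [if_neg hβ]
    rw [leadingCoeff_add_of_degree_lt', leadingCoeff_C_mul_X_pow]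
    · simp only [sign_eq_neg_sign_iff hα hβ]
    · rw [degree_C_mul_X_pow l hβ, degree_one]
      exact_mod_cast hl

theorem trinomial_one_comp_neg_X (k l : ℕ) (α β : ℝ) :
    (C α * X ^ k + C β * X ^ l + 1 : ℝ[X]).comp (-X)
      = C ((-1) ^ k * α) * X ^ k + C ((-1) ^ l * β) * X ^ l + 1 := by
  simp only [add_comp, mul_comp, C_comp, pow_comp, X_comp, one_comp, neg_pow (X : ℝ[X]), C_mul, C_pow,
    C_neg, C_1]
  ring

/-- Descartes' bound for the number of real zeros of a trinomial. -/
theorem card_roots_trinomial_one_le {k l : ℕ} (hl : 1 ≤ l) (hlk : l < k) (hkl : Nat.Coprime k l)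
    {α β : ℝ} (hα : α ≠ 0) :
    (C α * X ^ k + C β * X ^ l + 1 : ℝ[X]).roots.card ≤ nullCollinearCount k := by
  set f : ℝ[X] := C α * X ^ k + C β * X ^ l + 1 with hf
  have hpos := roots_countP_pos_le_signVariations f
  have hneg := roots_countP_pos_le_signVariations (f.comp (-X))
  rw [roots_comp_neg_X, Multiset.countP_map, ← Multiset.countP_eq_card_filter] at hneg
  have hcard : f.roots.card
      = f.roots.countP (0 < ·) + f.roots.countP (fun x => 0 < -x) := by
    rw [Multiset.card_eq_countP_add_countP (0 < ·) f.roots]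
    congr 1
    refine Multiset.countP_congr rfl fun x hx => ?_
    have hx0 : x ≠ 0 := by
      rintro rfl
      have := isRoot_of_mem_roots hx
      simp [hf, show k ≠ 0 by omega, show l ≠ 0 by omega] at this
    simp only [not_lt, neg_pos, eq_iff_iff]
    exact ⟨fun h => lt_of_le_of_ne h hx0, le_of_lt⟩
  have hodd : Odd k ∨ Odd l := by
    by_contra! h
    rw [Nat.not_odd_iff_even, Nat.not_odd_iff_even] at h
    exact Nat.not_coprime_of_dvd_of_dvd one_lt_two h.1.two_dvd h.2.two_dvd hkl
  rw [hf, trinomial_one_comp_neg_X,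
    signVariations_trinomial_one hl hlk (mul_ne_zero (by simp) hα)] at hneg
  rw [hf, signVariations_trinomial_one hl hlk hα] at hpos
  rw [← hf] at hneg hpos
  rw [hcard, nullCollinearCount]
  refine (add_le_add hpos hneg).trans ?_
  clear hpos hneg hcard
  by_cases hβ : β = 0
  · simp only [hβ, mul_zero, if_true]
    split_ifs <;> simp
  · have hβ' : (-1) ^ l * β ≠ 0 := mul_ne_zero (by simp) hβ
    rw [if_neg hβ, if_neg hβ']
    rcases Nat.even_or_odd k with hk | hk
    · rw [if_neg (Nat.not_odd_iff_even.2 hk)]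
      have hlo := hodd.resolve_left (Nat.not_odd_iff_even.2 hk)
      simp only [hk.neg_one_pow, hlo.neg_one_pow, one_mul, neg_mul, mul_neg, neg_lt_zero]
      split_ifs <;> linarith
    · rw [if_pos hk]
      rcases Nat.even_or_odd l with hlo | hlo <;>
      · simp only [hk.neg_one_pow, hlo.neg_one_pow, one_mul, neg_mul, mul_neg, neg_lt_zero, neg_neg]
        split_ifs <;> linarith

theorem exists_isRoot_of_odd_natDegree {f : ℝ[X]} (hf : Odd f.natDegree) : ∃ x, f.IsRoot x := by
  wlog hlead : 0 ≤ f.leadingCoeff generalizing f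
  · obtain ⟨x, hx⟩ := this (f := -f) (by simpa using hf) (by
      rw [leadingCoeff_neg]; linarith)
    exact ⟨x, by simpa [IsRoot] using hx⟩
  have hdeg : 0 < f.natDegree := hf.pos
  have htop := f.tendsto_atTop_of_leadingCoeff_nonneg (natDegree_pos_iff_degree_pos.1 hdeg) hlead
  have hnd : (f.comp (-X)).natDegree = f.natDegree := by
    rw [natDegree_comp, natDegree_neg, natDegree_X, mul_one]
  have hbot := (f.comp (-X)).tendsto_atBot_of_leadingCoeff_nonpos
    (natDegree_pos_iff_degree_pos.1 (by rwa [hnd])) (by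
      rw [leadingCoeff_comp (by simp), leadingCoeff_neg, leadingCoeff_X, hf.neg_one_pow]
      linarith)
  obtain ⟨x, hx⟩ := (htop.eventually_ge_atTop 0).exists
  obtain ⟨y, hy⟩ := (hbot.eventually_le_atBot 0).exists
  rw [eval_comp] at hy
  obtain ⟨z, hz⟩ := mem_range_of_exists_le_of_exists_ge f.continuous ⟨_, hy⟩ ⟨_, hx⟩
  exact ⟨z, hz⟩

/-- After removing two linear factors the cofactor would still have odd degree, hence a further real
zero. -/
theorem card_roots_ne_two_of_odd_natDegree {f : ℝ[X]} (hf : Odd f.natDegree) :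
    f.roots.card ≠ 2 := by
  intro h2
  obtain ⟨q, hq, hdeg, hroots⟩ := exists_prod_multiset_X_sub_C_mul f
  rw [h2] at hdeg
  have hodd : Odd q.natDegree := by
    rw [← hdeg] at hf
    exact (Nat.odd_add'.1 hf).2 even_two
  obtain ⟨x, hx⟩ := exists_isRoot_of_odd_natDegree hodd
  have hq0 : q ≠ 0 := by rintro rfl; simp at hodd
  have := (mem_roots hq0).2 hx
  simp [hroots] at this

/-- The number of real zeros of a real trinomial with zeros of both signs. -/
theorem card_roots_trinomial_one {k l : ℕ} (hl : 1 ≤ l) (hlk : l < k) (hkl : Nat.Coprime k l)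
    {α β : ℝ} (hα : α ≠ 0) {r s : ℝ} (hrs : r ≠ s)
    (hr : (C α * X ^ k + C β * X ^ l + 1 : ℝ[X]).IsRoot r)
    (hs : (C α * X ^ k + C β * X ^ l + 1 : ℝ[X]).IsRoot s) :
    (C α * X ^ k + C β * X ^ l + 1 : ℝ[X]).roots.card = nullCollinearCount k := by
  have hdeg := natDegree_trinomial_one (β := β) hl hlk hα
  have hle := card_roots_trinomial_one_le (β := β) hl hlk hkl hα
  set f : ℝ[X] := C α * X ^ k + C β * X ^ l + 1
  have hf : f ≠ 0 := by
    intro h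
    rw [h, natDegree_zero] at hdeg
    omega
  have h2 : 2 ≤ f.roots.card := by
    have hsub : ({r, s} : Multiset ℝ) ≤ f.roots := by
      rw [Multiset.le_iff_subset (by simpa using hrs)]
      intro x hx
      rcases (by simpa using hx : x = r ∨ x = s) with rfl | rfl
      · exact (mem_roots hf).2 hr
      · exact (mem_roots hf).2 hs
    simpa using Multiset.card_le_card hsub
  rw [nullCollinearCount] at hle ⊢
  split_ifs at hle ⊢ with hk
  · have := card_roots_ne_two_of_odd_natDegree (f := f) (by rwa [hdeg])
    omega
  · omega

/-! ### Zeros on a line through the origin. -/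

theorem trinomialAt_comp_C_mul_X {k l : ℕ} {A B : ℂ[X]} {z u : ℂ} {α β : ℝ}
    (ha : A.eval z * u ^ k = α) (hb : B.eval z * u ^ l = β) :
    (trinomialAt k l A B z).comp (C u * X)
      = (C α * X ^ k + C β * X ^ l + 1 : ℝ[X]).map Complex.ofRealHom := by
  simp only [trinomialAt, add_comp, mul_comp, C_comp, pow_comp, X_comp, one_comp, mul_pow,
    Polynomial.map_add, Polynomial.map_mul, map_C, Polynomial.map_pow, map_X, Polynomial.map_one,
    Complex.ofRealHom_eq_coe, ← ha, ← hb, C_mul, C_pow]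
  ring

/-- The zeros on a line are the real zeros of the trinomial rotated to the real axis. -/
theorem zerosOnLine_trinomialAt {k l : ℕ} {A B : ℂ[X]} {z u : ℂ} {α β : ℝ} (hu : u ≠ 0)
    (ha : A.eval z * u ^ k = α) (hb : B.eval z * u ^ l = β) :
    zerosOnLine (trinomialAt k l A B z) u
      = (C α * X ^ k + C β * X ^ l + 1 : ℝ[X]).roots.map (fun r : ℝ => (r : ℂ) * u) := by
  classical
  have hcomp := trinomialAt_comp_C_mul_X ha hb
  have h1 := map_roots_comp_C_mul_X_add_C (trinomialAt k l A B z) u 0 (isUnit_iff_ne_zero.2 hu)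
  have h2 := filter_roots_map_range_eq_map_roots (f := Complex.ofRealHom)
    Complex.ofRealHom.injective (C α * X ^ k + C β * X ^ l + 1 : ℝ[X])
  simp only [C_0, add_zero] at h1
  rw [hcomp] at h1
  rw [zerosOnLine, ← h1, Multiset.filter_map]
  have h3 : ∀ w : ℂ, u * w ∈ lineThroughOrigin u ↔ w ∈ Complex.ofRealHom.range := by
    intro w
    constructor
    · rintro ⟨r, hr⟩
      exact ⟨r, by
        rw [mul_comm] at hr
        exact (mul_right_cancel₀ hu hr).symm⟩
    · rintro ⟨r, rfl⟩
      exact ⟨r, mul_comm _ _⟩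
  have h4 : Multiset.map (fun r : ℝ => (r : ℂ) * u) (C α * X ^ k + C β * X ^ l + 1 : ℝ[X]).roots
      = Multiset.map (fun w => u * w)
        (Multiset.map Complex.ofRealHom (C α * X ^ k + C β * X ^ l + 1 : ℝ[X]).roots) := by
    rw [Multiset.map_map]
    exact Multiset.map_congr rfl fun r _ => mul_comm _ _
  rw [h4, ← h2]
  congr 1
  exact Multiset.filter_congr fun w _ => h3 w

theorem isRoot_trinomialAt_iff {k l : ℕ} {A B : ℂ[X]} {z t : ℂ} :
    (trinomialAt k l A B z).IsRoot t ↔ A.eval z * t ^ k + B.eval z * t ^ l + 1 = 0 := by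
  simp [trinomialAt, IsRoot]

theorem isRoot_trinomialAt_ofReal_mul_iff {k l : ℕ} {A B : ℂ[X]} {z u : ℂ} {α β : ℝ}
    (ha : A.eval z * u ^ k = α) (hb : B.eval z * u ^ l = β) (r : ℝ) :
    (trinomialAt k l A B z).IsRoot (r * u) ↔
      (C α * X ^ k + C β * X ^ l + 1 : ℝ[X]).IsRoot r := by
  rw [isRoot_trinomialAt_iff, mul_pow, mul_pow]
  rw [show A.eval z * ((r : ℂ) ^ k * u ^ k) + B.eval z * ((r : ℂ) ^ l * u ^ l) + 1
    = ((α * r ^ k + β * r ^ l + 1 : ℝ) : ℂ) by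
      push_cast; rw [← ha, ← hb]; ring]
  rw [Complex.ofReal_eq_zero]
  simp [IsRoot]

/-- Two opposite zeros on a line make the trinomial real on that line. -/
theorem exists_real_coeffs_of_hasZerosOnBothSides {k l : ℕ} (hlk : l < k)
    (hkl : Nat.Coprime k l) {A B : ℂ[X]} {z u : ℂ}
    (h : HasZerosOnBothSides (trinomialAt k l A B z) u) :
    ∃ α β r s : ℝ, A.eval z * u ^ k = α ∧ B.eval z * u ^ l = β ∧ 0 < r ∧ s < 0 ∧
      (trinomialAt k l A B z).IsRoot (r * u) ∧ (trinomialAt k l A B z).IsRoot (s * u) := by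
  obtain ⟨⟨r, hr, hr'⟩, s, hs, hs'⟩ := h
  have er := isRoot_trinomialAt_iff.1 hr'
  have es := isRoot_trinomialAt_iff.1 hs'
  rw [mul_pow, mul_pow] at er es
  set a := A.eval z * u ^ k with ha
  set b := B.eval z * u ^ l with hb
  have er' : a * (r : ℂ) ^ k + b * (r : ℂ) ^ l + 1 = 0 := by rw [ha, hb]; linear_combination er
  have es' : a * (s : ℂ) ^ k + b * (s : ℂ) ^ l + 1 = 0 := by rw [ha, hb]; linear_combination es
  -- A zero determinant forces `r = -s` with `k - l` even. By coprimality `k` and `l` are then odd,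
  -- and adding the two equations gives `2 = 0`.
  have hdet : r ^ k * s ^ l - r ^ l * s ^ k ≠ 0 := by
    intro hd
    have hfac : r ^ l * s ^ l * (r ^ (k - l) - s ^ (k - l)) = 0 := by
      rw [← hd]
      conv_rhs => rw [show k = l + (k - l) by omega, pow_add, pow_add]
      ring
    have hpow : r ^ (k - l) = s ^ (k - l) := by
      have : r ^ l * s ^ l ≠ 0 := mul_ne_zero (pow_ne_zero _ hr.ne') (pow_ne_zero _ hs.ne)
      exact sub_eq_zero.1 ((mul_eq_zero.1 hfac).resolve_left this)
    have hkl0 : k - l ≠ 0 := by omega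
    rcases Nat.even_or_odd (k - l) with hev | hodd
    · have habs : r = -s := by
        have := (hev.pow_abs s).symm
        rw [← hpow] at this
        have := (pow_left_inj₀ hr.le (abs_nonneg s) hkl0).1 this
        rwa [abs_of_neg hs] at this
      have hlo : Odd l := by
        by_contra hle
        rw [Nat.not_odd_iff_even] at hle
        have hke : Even k := by
          have := hev.add hle
          rwa [Nat.sub_add_cancel hlk.le] at this
        exact Nat.not_coprime_of_dvd_of_dvd one_lt_two hke.two_dvd hle.two_dvd hkl
      have hko : Odd k := by
        have := hev.add_odd hlo
        rwa [Nat.sub_add_cancel hlk.le] at this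
      rw [habs] at er'
      push_cast at er'
      rw [hko.neg_pow, hlo.neg_pow] at er'
      have : (2 : ℂ) = 0 := by linear_combination er' + es'
      norm_num at this
    · have : s ^ (k - l) < 0 := hodd.pow_neg hs
      have : 0 < r ^ (k - l) := by positivity
      linarith
  have hdetC : ((r ^ k * s ^ l - r ^ l * s ^ k : ℝ) : ℂ) ≠ 0 := by exact_mod_cast hdet
  -- Cramer's rule for the real linear system in `a` and `b`.
  refine ⟨(r ^ l - s ^ l) / (r ^ k * s ^ l - r ^ l * s ^ k),
    (s ^ k - r ^ k) / (r ^ k * s ^ l - r ^ l * s ^ k), r, s, ?_, ?_, hr, hs, hr', hs'⟩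
  · rw [Complex.ofReal_div, eq_div_iff hdetC]
    push_cast
    linear_combination (s : ℂ) ^ l * er' - (r : ℂ) ^ l * es'
  · rw [Complex.ofReal_div, eq_div_iff hdetC]
    push_cast
    linear_combination (r : ℂ) ^ k * es' - (s : ℂ) ^ k * er'

theorem card_zerosOnLine_trinomialAt {k l : ℕ} (hl : 1 ≤ l) (hlk : l < k)
    (hkl : Nat.Coprime k l) {A B : ℂ[X]} {z u : ℂ} (hA : A.eval z ≠ 0) (hu : u ≠ 0)
    (h : HasZerosOnBothSides (trinomialAt k l A B z) u) :
    (zerosOnLine (trinomialAt k l A B z) u).card = nullCollinearCount k := by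
  obtain ⟨α, β, r, s, ha, hb, hr, hs, hr', hs'⟩ :=
    exists_real_coeffs_of_hasZerosOnBothSides hlk hkl h
  have hα : α ≠ 0 := by
    rintro rfl
    exact mul_ne_zero hA (pow_ne_zero k hu) (by simpa using ha)
  rw [zerosOnLine_trinomialAt hu ha hb, Multiset.card_map]
  exact card_roots_trinomial_one hl hlk hkl hα (by linarith : s < r).ne'
    ((isRoot_trinomialAt_ofReal_mul_iff ha hb r).1 hr')
    ((isRoot_trinomialAt_ofReal_mul_iff ha hb s).1 hs')

/-! ### Equal moduli, rotation to real coefficients, and real zeros. -/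

/-- Without middle term the trinomial has two distinct zeros of equal modulus. -/
theorem exists_isRoot_norm_eq_of_eval_eq_zero {k l : ℕ} (hk : 2 ≤ k) {A B : ℂ[X]} {z : ℂ}
    (hA : A.eval z ≠ 0) (hB : B.eval z = 0) :
    ∃ t₁ t₂ : ℂ, t₁ ≠ t₂ ∧ (trinomialAt k l A B z).IsRoot t₁ ∧
      (trinomialAt k l A B z).IsRoot t₂ ∧ ‖t₁‖ = ‖t₂‖ := by
  obtain ⟨t, ht⟩ := IsAlgClosed.exists_pow_nat_eq (-(A.eval z)⁻¹) (show 0 < k by omega)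
  have hζ := Complex.isPrimitiveRoot_exp k (by omega)
  set ζ := Complex.exp (2 * Real.pi * Complex.I / k)
  have ht0 : t ≠ 0 := by
    rintro rfl
    rw [zero_pow (by omega), eq_comm, neg_eq_zero, inv_eq_zero] at ht
    exact hA ht
  refine ⟨t, t * ζ, ?_, ?_, ?_, ?_⟩
  · intro h
    exact hζ.ne_one (by omega) (mul_left_cancel₀ ht0 (by rw [mul_one]; exact h.symm))
  · rw [isRoot_trinomialAt_iff, hB, ht]
    field_simp; ring
  · rw [isRoot_trinomialAt_iff, hB, mul_pow, hζ.pow_eq_one, ht]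
    field_simp; ring
  · rw [norm_mul, hζ.norm'_eq_one (by omega), mul_one]

/-- At a zero of the sequence the trinomial is real, with known signs, on some line. -/
theorem exists_rotation_of_arg_eq_pi {k l : ℕ} (hkl : Nat.Coprime k l) {a b : ℂ} (ha : a ≠ 0)
    (hb : b ≠ 0) (harg : ((-a) ^ l / (-b) ^ k).arg = Real.pi) :
    ∃ u : ℂ, u ≠ 0 ∧ a * u ^ k = (‖a‖ : ℝ) ∧ b * u ^ l = ((-1) ^ l * ‖b‖ : ℝ) := by
  have hna : (‖a‖ : ℂ) ≠ 0 := by simpa using ha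
  have hnb : (‖b‖ : ℂ) ≠ 0 := by simpa using hb
  have hpol := Complex.norm_mul_exp_arg_mul_I ((-a) ^ l / (-b) ^ k)
  rw [harg, Complex.exp_pi_mul_I, norm_div, norm_pow, norm_pow, norm_neg, norm_neg, neg_pow a,
    neg_pow b] at hpol
  push_cast at hpol
  have hsq : ∀ n : ℕ, ((-1 : ℂ) ^ n) * (-1) ^ n = 1 := fun n => by
    rw [← mul_pow]; simp
  -- Equivalent to `(k + 1) * (l + 1)` being even, which holds because `k` and `l` are not both
  -- even.
  have hsign : ((-1 : ℂ) ^ l) ^ k = -((-1) ^ l * (-1) ^ k) := by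
    rcases Nat.even_or_odd l with hl | hl
    · have hk : Odd k := by
        by_contra hk
        rw [Nat.not_odd_iff_even] at hk
        exact Nat.not_coprime_of_dvd_of_dvd one_lt_two hk.two_dvd hl.two_dvd hkl
      simp [hl.neg_one_pow, hk.neg_one_pow]
    · simp [hl.neg_one_pow]
  obtain ⟨u, hu, hul, huk⟩ := exists_pow_eq_and_pow_eq hkl (x := (-1) ^ l * ‖b‖ / b)
    (y := ‖a‖ / a) (div_ne_zero (mul_ne_zero (by simp) hnb) hb) (div_ne_zero hna ha) (by
      rw [div_pow, div_pow, mul_pow, hsign]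
      have h1 : (-1 : ℂ) ^ k ≠ 0 := by simp
      field_simp at hpol ⊢
      linear_combination (-1) ^ k * hpol + (‖a‖ ^ l * b ^ k) * hsq k)
  refine ⟨u, hu, ?_, ?_⟩
  · rw [huk]; field_simp
  · rw [hul]; push_cast; field_simp

theorem eval_map_ofReal_conj (f : ℝ[X]) (w : ℂ) :
    (f.map Complex.ofRealHom).eval (starRingEnd ℂ w)
      = starRingEnd ℂ ((f.map Complex.ofRealHom).eval w) := by
  rw [eval_map, eval_map, hom_eval₂]
  congr 1
  ext x
  simp

/-- A real polynomial without distinct zeros of equal modulus has only real zeros. -/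
theorem card_roots_eq_natDegree_of_norm_injOn {f : ℝ[X]}
    (h : ∀ w₁ w₂ : ℂ, (f.map Complex.ofRealHom).IsRoot w₁ → (f.map Complex.ofRealHom).IsRoot w₂ →
      ‖w₁‖ = ‖w₂‖ → w₁ = w₂) : f.roots.card = f.natDegree := by
  classical
  have h1 := filter_roots_map_range_eq_map_roots (f := Complex.ofRealHom)
    Complex.ofRealHom.injective f
  rw [Multiset.filter_eq_self.2 ?_] at h1
  · have h2 := splits_iff_card_roots.1 (IsAlgClosed.splits (f.map Complex.ofRealHom))
    rw [h1, Multiset.card_map, natDegree_map] at h2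
    exact h2
  · intro w hw
    have hw' := isRoot_of_mem_roots hw
    have hc : (f.map Complex.ofRealHom).IsRoot (starRingEnd ℂ w) := by
      rw [IsRoot, eval_map_ofReal_conj, hw', map_zero]
    have := h w _ hw' hc (by simp)
    exact ⟨w.re, Complex.conj_eq_iff_re.1 this.symm⟩

/-! ### Low-degree recurrences without zeros. -/

/-- The rotated terms `P_n(z) u^n` are positive: the discriminant condition preserves a growth ratio
of at least `β / 2`, the mean of the characteristic roots. -/
theorem quadratic_recSeq_eval_ne_zero {A B : ℂ[X]} {z u : ℂ} {α β : ℝ} (hβ : 0 < β)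
    (ha : A.eval z * u ^ 2 = α) (hb : B.eval z * u ^ 1 = (-β : ℝ)) (hdisc : 4 * α ≤ β ^ 2)
    (n : ℕ) : (recSeq 2 1 A B n).eval z ≠ 0 := by
  have h0 : (recSeq 2 1 A B 0).eval z = 1 := by simp [recSeq_zero]
  have h1 : (recSeq 2 1 A B 1).eval z = -B.eval z := by
    simp [eval_recSeq_rec (k := 2) (l := 1) le_rfl (by norm_num) A B z (n := 1) le_rfl, h0]
  have key : ∀ n : ℕ, ∃ r s : ℝ, (recSeq 2 1 A B n).eval z * u ^ n = r ∧
      (recSeq 2 1 A B (n + 1)).eval z * u ^ (n + 1) = s ∧ 0 < r ∧ β * r ≤ 2 * s := by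
    intro n
    induction n with
    | zero =>
      refine ⟨1, β, by simp [h0], ?_, one_pos, by linarith⟩
      rw [zero_add, h1, neg_mul, hb]
      simp
    | succ n ih =>
      obtain ⟨r, s, hr, hs, hr0, hrs⟩ := ih
      have hs0 : 0 < s := by nlinarith
      refine ⟨s, β * s - α * r, hs, ?_, hs0, ?_⟩
      · have := eval_recSeq_rec (k := 2) (l := 1) le_rfl (by norm_num) A B z (n := n + 2) (by omega)
        rw [if_pos (by omega), if_pos (by omega), show n + 2 - 1 = n + 1 by omega,
          show n + 2 - 2 = n by omega] at this
        rw [show n + 1 + 1 = n + 2 by omega, this]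
        push_cast at hb ⊢
        rw [← hr, ← hs, ← ha]
        linear_combination (-(recSeq 2 1 A B (n + 1)).eval z * u ^ (n + 1)) * hb
      · nlinarith
  intro h
  obtain ⟨r, s, hr, -, hr0, -⟩ := key n
  rw [h, zero_mul, eq_comm, Complex.ofReal_eq_zero] at hr
  exact hr0.ne' hr

/-- The characteristic polynomial of the rotated sequence is `(x - 2c)^2 (x + c)`. Growth by at
least the double root `2c` is preserved, so all terms are positive. -/
theorem cubic_recSeq_eval_ne_zero {A B : ℂ[X]} {z u : ℂ} {c : ℝ} (hc : 0 < c)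
    (ha : A.eval z * u ^ 3 = (4 * c ^ 3 : ℝ)) (hb : B.eval z * u ^ 1 = (-(3 * c) : ℝ))
    (n : ℕ) : (recSeq 3 1 A B n).eval z ≠ 0 := by
  have hrec := fun n => eval_recSeq_rec (k := 3) (l := 1) le_rfl (by norm_num) A B z (n := n)
  have h0 : (recSeq 3 1 A B 0).eval z = 1 := by simp [recSeq_zero]
  have h1 : (recSeq 3 1 A B 1).eval z = -B.eval z := by simp [hrec 1 le_rfl, h0]
  have h2 : (recSeq 3 1 A B 2).eval z = B.eval z ^ 2 := by
    rw [hrec 2 (by norm_num)]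
    simp [h1, sq]
  push_cast at ha hb
  have key : ∀ n : ℕ, ∃ r s t : ℝ, (recSeq 3 1 A B n).eval z * u ^ n = r ∧
      (recSeq 3 1 A B (n + 1)).eval z * u ^ (n + 1) = s ∧
      (recSeq 3 1 A B (n + 2)).eval z * u ^ (n + 2) = t ∧
      0 < r ∧ 2 * c * r ≤ s ∧ 2 * c * s ≤ t := by
    intro n
    induction n with
    | zero =>
      refine ⟨1, 3 * c, 9 * c ^ 2, by simp [h0], ?_, ?_, one_pos, by linarith, by nlinarith⟩
      · rw [zero_add, h1, neg_mul, hb]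
        push_cast; ring
      · rw [zero_add, h2, show B.eval z ^ 2 * u ^ 2 = (B.eval z * u ^ 1) ^ 2 by ring, hb]
        push_cast; ring
    | succ n ih =>
      obtain ⟨r, s, t, hr, hs, ht, hr0, hrs, hst⟩ := ih
      have hs0 : 0 < s := lt_of_lt_of_le (by positivity) hrs
      refine ⟨s, t, 3 * c * t - 4 * c ^ 3 * r, hs, ht, ?_, hs0, hst, ?_⟩
      · have := hrec (n + 3) (by omega)
        rw [if_pos (by omega), if_pos (by omega), show n + 3 - 1 = n + 2 by omega,
          show n + 3 - 3 = n by omega] at this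
        rw [show n + 1 + 2 = n + 3 by omega, this]
        push_cast
        rw [← hr, ← ht]
        linear_combination (-(recSeq 3 1 A B (n + 2)).eval z * u ^ (n + 2)) * hb
          - ((recSeq 3 1 A B n).eval z * u ^ n) * ha
      · have e1 : 2 * c * (2 * c * r) ≤ t := le_trans (by gcongr) hst
        have e2 : c * (2 * c * (2 * c * r)) ≤ c * t := by gcongr
        nlinarith
  intro h
  obtain ⟨r, s, t, hr, -, -, hr0, -, -⟩ := key n
  rw [h, zero_mul, eq_comm, Complex.ofReal_eq_zero] at hr
  exact hr0.ne' hr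

/-! ### The dichotomy for the zeros of the trinomial. -/

/-- If the real zeros are simple, the null-collinear zeros are counted without multiplicity. -/
theorem hasNullCollinearZeros_of_nodup {k l : ℕ} (hl : 1 ≤ l) (hlk : l < k)
    (hkl : Nat.Coprime k l) {A B : ℂ[X]} {z u : ℂ} {α β : ℝ} (hA : A.eval z ≠ 0) (hu : u ≠ 0)
    (ha : A.eval z * u ^ k = α) (hb : B.eval z * u ^ l = β)
    (hnd : (C α * X ^ k + C β * X ^ l + 1 : ℝ[X]).roots.Nodup)
    (h : HasZerosOnBothSides (trinomialAt k l A B z) u) :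
    HasNullCollinearZeros (trinomialAt k l A B z) u (nullCollinearCount k) := by
  classical
  refine ⟨h, ?_⟩
  rw [← card_zerosOnLine_trinomialAt hl hlk hkl hA hu h]
  have hnd' : (zerosOnLine (trinomialAt k l A B z) u).Nodup := by
    rw [zerosOnLine_trinomialAt hu ha hb]
    exact hnd.map fun x y hxy => Complex.ofReal_injective (mul_right_cancel₀ hu hxy)
  have hne : trinomialAt k l A B z ≠ 0 := by
    intro h0
    have := congrArg (eval 0) h0
    simp [trinomialAt, show k ≠ 0 by omega, show l ≠ 0 by omega] at this
  have hset : {t : ℂ | (trinomialAt k l A B z).IsRoot t ∧ t ∈ lineThroughOrigin u}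
      = (zerosOnLine (trinomialAt k l A B z) u).toFinset := by
    ext t
    simp [zerosOnLine, hne]
  rw [hset, Set.ncard_coe_finset, Multiset.toFinset_card_of_nodup hnd']

/-- Vieta's relations for a double zero `x` of `α t^3 - β t + 1` give `y = -2x` and `α x^3 = 1/2`;
the parameter is `c = 1/(2x)`. -/
theorem exists_double_root_parameter {α β x y : ℝ} (hα : 0 < α)
    (h1 : x + x + y = 0) (h2 : α * (x * x + x * y + x * y) = -β) (h3 : α * (x * x * y) = -1) :
    ∃ c : ℝ, 0 < c ∧ α = 4 * c ^ 3 ∧ β = 3 * c := by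
  obtain rfl : y = -2 * x := by linarith
  have h4 : α * x ^ 3 = 1 / 2 := by linarith
  have hx3 : 0 < x ^ 3 := by
    by_contra! h
    nlinarith
  have hx : 0 < x := by
    by_contra! h
    exact absurd (Odd.pow_nonpos (by decide : Odd 3) h) (by linarith)
  refine ⟨1 / (2 * x), by positivity, ?_, ?_⟩
  · field_simp; linarith
  · field_simp
    linear_combination 2 * x * h2 + 6 * h4

theorem eval_eq_of_roots_eq_triple {f : ℝ[X]} (hdeg : f.natDegree = 3) {x y z : ℝ}
    (h : f.roots = {x, y, z}) (t : ℝ) :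
    f.eval t = f.leadingCoeff * ((t - x) * (t - y) * (t - z)) := by
  have := C_leadingCoeff_mul_prod_multiset_X_sub_C (p := f) (by rw [h, hdeg]; rfl)
  rw [h] at this
  conv_lhs => rw [← this]
  simp [mul_assoc]

theorem exists_norm_eq_or_hasNullCollinearZeros {k l : ℕ} (hl : 1 ≤ l) (hlk : l < k)
    (hkl : Nat.Coprime k l) {A B : ℂ[X]} {z : ℂ} (hA : A.eval z ≠ 0) {n : ℕ}
    (hn : recSeq k l A B n ≠ 0) (hz : (recSeq k l A B n).IsRoot z) :
    (∃ t₁ t₂ : ℂ, t₁ ≠ t₂ ∧ (trinomialAt k l A B z).IsRoot t₁ ∧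
        (trinomialAt k l A B z).IsRoot t₂ ∧ ‖t₁‖ = ‖t₂‖) ∨
      (∃ u : ℂ, u ≠ 0 ∧
        HasNullCollinearZeros (trinomialAt k l A B z) u (nullCollinearCount k)) := by
  rw [or_iff_not_imp_left]
  intro hmod
  by_cases hB : B.eval z = 0
  · exact absurd (exists_isRoot_norm_eq_of_eval_eq_zero (by omega) hA hB) hmod
  obtain ⟨u, hu, ha, hb⟩ := exists_rotation_of_arg_eq_pi hkl hA hB
    (arg_eq_pi_of_isRoot hl (by omega) hkl hA hB hn hz)
  have hα : 0 < ‖A.eval z‖ := norm_pos_iff.2 hA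
  have hβ : 0 < ‖B.eval z‖ := norm_pos_iff.2 hB
  set α := ‖A.eval z‖
  set β := ‖B.eval z‖
  have hdeg := natDegree_trinomial_one (β := (-1) ^ l * β) hl hlk hα.ne'
  have hle := card_roots_trinomial_one_le (β := (-1) ^ l * β) hl hlk hkl hα.ne'
  have hlead : (C α * X ^ k + C ((-1) ^ l * β) * X ^ l + 1 : ℝ[X]).leadingCoeff = α := by
    rw [leadingCoeff, hdeg]
    simp only [coeff_add, coeff_C_mul_X_pow, coeff_one]
    simp [show k ≠ l by omega, show k ≠ 0 by omega]
  have hcard := card_roots_eq_natDegree_of_norm_injOn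
    (f := C α * X ^ k + C ((-1) ^ l * β) * X ^ l + 1) (fun w₁ w₂ h₁ h₂ hw => by
      by_contra hne
      rw [← trinomialAt_comp_C_mul_X ha hb] at h₁ h₂
      simp only [IsRoot, eval_comp, eval_mul, eval_C, eval_X] at h₁ h₂
      exact hmod ⟨u * w₁, u * w₂, fun h => hne (mul_left_cancel₀ hu h), h₁, h₂, by
        rw [norm_mul, norm_mul, hw]⟩)
  have heval : ∀ t, (C α * X ^ k + C ((-1) ^ l * β) * X ^ l + 1 : ℝ[X]).eval t
      = α * t ^ k + (-1) ^ l * β * t ^ l + 1 := fun t => by simp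
  have hroot := isRoot_trinomialAt_ofReal_mul_iff ha hb
  have hnull := hasNullCollinearZeros_of_nodup hl hlk hkl hA hu ha hb
  set f : ℝ[X] := C α * X ^ k + C ((-1) ^ l * β) * X ^ l + 1
  rw [hdeg] at hcard
  rw [hcard, nullCollinearCount] at hle
  -- All `k` zeros are real, while Descartes allows three for odd `k` and two for even `k`.
  have hk23 : k = 2 ∨ k = 3 := by
    split_ifs at hle with hk
    · rcases hk with ⟨m, rfl⟩; omega
    · omega
  rcases hk23 with rfl | rfl
  · obtain rfl : l = 1 := by omega
    exfalso
    obtain ⟨x, hx⟩ := Multiset.card_pos_iff_exists_mem.1 (by omega : 0 < f.roots.card)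
    have hx' := isRoot_of_mem_roots hx
    rw [IsRoot, heval] at hx'
    refine quadratic_recSeq_eval_ne_zero hβ ha (by rw [hb]; simp) ?_ n hz
    -- At a real zero `x`, the square `(2αx - β)^2` equals the discriminant.
    nlinarith [sq_nonneg (2 * α * x - β)]
  · obtain ⟨x, y, w, hxyw⟩ := Multiset.card_eq_three.1 hcard
    have hfac := eval_eq_of_roots_eq_triple hdeg hxyw
    simp only [heval, hlead] at hfac
    -- The values at `0`, `1` and `-1` yield Vieta's relations by linear arithmetic.
    have f0 := hfac 0
    have f1 := hfac 1
    have f2 := hfac (-1)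
    have hmem : ∀ t, t = x ∨ t = y ∨ t = w → f.IsRoot t := fun t ht =>
      isRoot_of_mem_roots (by rw [hxyw]; simpa using ht)
    have hcases : l = 1 ∨ l = 2 := by omega
    rcases hcases with rfl | rfl
    · have e1 : x + y + w = 0 := by
        have : α * (x + y + w) = 0 := by linarith
        exact (mul_eq_zero.1 this).resolve_left hα.ne'
      have e2 : α * (x * y + x * w + y * w) = -β := by linarith
      have e3 : α * (x * y * w) = -1 := by linarith
      have hno : ∀ c : ℝ, 0 < c → α = 4 * c ^ 3 → ¬ β = 3 * c := fun c hc h1 h2 =>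
        cubic_recSeq_eval_ne_zero hc (by rw [ha, h1]) (by rw [hb, h2]; simp) n hz
      have hxy : x ≠ y := by
        rintro rfl
        obtain ⟨c, hc, h1, h2⟩ := exists_double_root_parameter hα (x := x) (y := w) (β := β)
          e1 (by linarith) e3
        exact hno c hc h1 h2
      have hxw : x ≠ w := by
        rintro rfl
        obtain ⟨c, hc, h1, h2⟩ := exists_double_root_parameter hα (x := x) (y := y) (β := β)
          (by linarith) (by linarith) (by linarith)
        exact hno c hc h1 h2
      have hyw : y ≠ w := by
        rintro rfl
        obtain ⟨c, hc, h1, h2⟩ := exists_double_root_parameter hα (x := y) (y := x) (β := β)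
          (by linarith) (by linarith) (by linarith)
        exact hno c hc h1 h2
      refine ⟨u, hu, hnull (by rw [hxyw]; simp [hxy, hxw, hyw]) ⟨?_, ?_⟩⟩
      · by_contra! hneg
        have hle0 : ∀ t, t = x ∨ t = y ∨ t = w → t ≤ 0 := fun t ht => by
          by_contra! hpos
          exact hneg t hpos ((hroot t).2 (hmem t ht))
        have := hle0 x (by simp)
        have := hle0 y (by simp)
        have := hle0 w (by simp)
        exact hxy (by linarith)
      · by_contra! hpos
        have hge0 : ∀ t, t = x ∨ t = y ∨ t = w → 0 ≤ t := fun t ht => by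
          by_contra! hneg
          exact hpos t hneg ((hroot t).2 (hmem t ht))
        have := hge0 x (by simp)
        have := hge0 y (by simp)
        have := hge0 w (by simp)
        exact hxy (by linarith)
    · exfalso
      have e2 : x * y + x * w + y * w = 0 := by
        have : α * (x * y + x * w + y * w) = 0 := by linarith
        exact (mul_eq_zero.1 this).resolve_left hα.ne'
      -- For `l = 2` all coefficients are nonnegative, so every real zero is negative; the pairwise
      -- products are then positive, against `e2`.
      have hneg : ∀ t, t = x ∨ t = y ∨ t = w → t < 0 := fun t ht => by
        have := hmem t ht
        rw [IsRoot, heval] at this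
        by_contra! h0
        have : 0 < α * t ^ 3 + (-1) ^ 2 * β * t ^ 2 + 1 := by positivity
        linarith
      have := mul_pos_of_neg_of_neg (hneg x (by simp)) (hneg y (by simp))
      have := mul_pos_of_neg_of_neg (hneg x (by simp)) (hneg w (by simp))
      have := mul_pos_of_neg_of_neg (hneg y (by simp)) (hneg w (by simp))
      linarith

theorem corollary1p3 (k l : ℕ) (hl : 1 ≤ l) (hlk : l < k) (hkl : Nat.Coprime k l)
    (A B : ℂ[X]) (hA : A ≠ 0) (hB : B ≠ 0) (hAB : 1 ≤ (A * B).natDegree)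
    (z₀ : ℂ) (hz₀ : z₀ ∈ seqZeros (recSeq k l A B) \ polyZeros A) :
    ((∃ t₁ t₂ : ℂ, t₁ ≠ t₂ ∧ (trinomialAt k l A B z₀).IsRoot t₁ ∧
          (trinomialAt k l A B z₀).IsRoot t₂ ∧ ‖t₁‖ = ‖t₂‖) ∨
        (∃ u : ℂ, u ≠ 0 ∧
          HasNullCollinearZeros (trinomialAt k l A B z₀) u (nullCollinearCount k))) ∧
      (∀ u : ℂ, u ≠ 0 → HasZerosOnBothSides (trinomialAt k l A B z₀) u →
        (zerosOnLine (trinomialAt k l A B z₀) u).card = nullCollinearCount k) := by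
  obtain ⟨⟨n, hn, hz⟩, hA₀⟩ := hz₀
  exact ⟨exists_norm_eq_or_hasNullCollinearZeros hl hlk hkl hA₀ hn hz,
    fun u hu h => card_zerosOnLine_trinomialAt hl hlk hkl hA₀ hu h⟩
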